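/- A multicast network is a finite directed acyclic multigraph with a source node $s$, a finite set $T\not\ni s$ of receivers and an integer $\omega\ge 0$ such that for every $t\in T$ there are $\omega$ pairwise edge-disjoint directed paths from $s$ to $t$. Let $\mathbf{C}_L$ be the $L\times L$ cyclic permutation matrix over $\mathrm{GF}(2)$, with ones exactly in the positions $(i,\,i+1 \bmod L)$, $0\le i<L$. An $L$-dimensional circular-shift linear code (of degree $\delta \le L$) assigns to every pair $(d,e)$ of edges an $L\times L$ matrix $\mathbf{K}_{d,e}=\sum_{j=0}^{L-1}a_j\mathbf{C}_L^j$ over $\mathrm{GF}(2)$, with $a_j\in\{0,1\}$ and at most $\delta$ of the $a_j$ nonzero, such that $\mathbf{K}_{d,e}=\mathbf{0}$ unless $d$ enters the node that $e$ leaves. It determines global encoding kernels $\mathbf{F}_e$, matrices over $\mathrm{GF}(2)$ of size $|\mathrm{Out}(s)|L\times L$: the column-wise juxtaposition $[\mathbf{F}_e]_{e\in\mathrm{Out}(s)}$ is the identity matrix, and $\mathbf{F}_e=\sum_{d\in\mathrm{In}(v)}\mathbf{F}_d\mathbf{K}_{d,e}$ for every edge $e$ leaving a node $v\neq s$. Together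 with a source encoding matrix $\mathbf{G}_s$ over $\mathrm{GF}(2)$ of size $\omega L'\times|\mathrm{Out}(s)|L$, the code is an $(L',L)$ circular-shift linear solution if $\mathbf{G}_s[\mathbf{F}_e]_{e\in\mathrm{In}(t)}$ has full rank $\omega L'$ for every receiver $t\in T$. Theorem. Every multicast network is asymptotically circular-shift linearly solvable: for every $\varepsilon>0$ it has, for some $L'\ge 0$ and $L\ge 1$, an $(L',L)$ circular-shift linear solution with $L'/L>1-\varepsilon$. More precisely, for every $\varepsilon>0$ there is a prime $L$ such that the multiplicative order of $2$ modulo $L$ is at least $\max(1/\varepsilon,|T|)$, and for every such prime $L$ the network has an $(L-1,L)$ circular-shift linear solution, and $(L-1)/L>1-\varepsilon$. -/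

import Mathlib

/-- A directed multigraph with nodes `V` and edges `E`: the edge `e` leads from `src e` to
`dst e`; parallel edges are allowed. -/
structure DirectedMultigraph (V E : Type*) where
  /-- the node that an edge leaves -/
  src : E → V
  /-- the node that an edge enters -/
  dst : E → V

namespace DirectedMultigraph

variable {V E : Type*} (G : DirectedMultigraph V E)

/-- There is an edge from `u` to `v`. -/
def Step (u v : V) : Prop := ∃ e, G.src e = u ∧ G.dst e = v

/-- There is no directed cycle. -/
def IsAcyclic : Prop := ∀ v, ¬ Relation.TransGen G.Step v v

/-- `(d, e)` is an adjacent pair of edges: `d` enters the node that `e` leaves. -/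
def Adjacent (d e : E) : Prop := G.dst d = G.src e

/-- The list `p` of edges is a directed path from `u` to `v` (in an acyclic graph a directed walk
never repeats a node). -/
def IsPath : V → List E → V → Prop
  | u, [], v => u = v
  | u, e :: p, v => G.src e = u ∧ IsPath (G.dst e) p v

/-- There are `n` pairwise edge-disjoint directed paths from `u` to `v`. -/
def HasEdgeDisjointPaths (n : ℕ) (u v : V) : Prop :=
  ∃ P : Fin n → List E, (∀ i, G.IsPath u (P i) v) ∧ Pairwise fun i j => (P i).Disjoint (P j)

/-- The set `Out(v)` of outgoing edges of `v`. -/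
abbrev Out (v : V) : Type _ := {e : E // G.src e = v}

/-- The set `In(v)` of incoming edges of `v`. -/
abbrev In (v : V) : Type _ := {e : E // G.dst e = v}

theorem IsAcyclic.wellFounded_adjacent {G : DirectedMultigraph V E} [Finite E]
    (h : G.IsAcyclic) : WellFounded G.Adjacent := by
  have key : ∀ d e, Relation.TransGen G.Adjacent d e →
      Relation.TransGen G.Step (G.src d) (G.src e) := by
    intro d e hde
    induction hde with
    | single hb => exact .single ⟨d, rfl, hb⟩
    | @tail b c _ hbc ih => exact ih.tail ⟨b, rfl, hbc⟩
  have : Std.Irrefl (Relation.TransGen G.Adjacent) := ⟨fun e he => h _ (key e e he)⟩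
  exact Subrelation.wf (fun hde => Relation.TransGen.single hde)
    (Finite.wellFounded_of_trans_of_irrefl (Relation.TransGen G.Adjacent))

end DirectedMultigraph

/-- A multicast network: an acyclic directed multigraph with one source node and a set of
receivers, where each receiver is joined to the source by `ω` edge-disjoint paths, `ω` being the
number of data units that the source generates. -/
structure MulticastNetwork (V E : Type*) extends DirectedMultigraph V E where
  acyclic : toDirectedMultigraph.IsAcyclic
  /-- the source node -/
  source : V
  /-- the set of receivers -/
  receivers : Finset V
  source_notMem_receivers : source ∉ receivers
  /-- the number of source data units -/
  ω : ℕ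
  flow : ∀ t ∈ receivers, toDirectedMultigraph.HasEdgeDisjointPaths ω source t

/-- The `L × L` cyclic permutation matrix over GF(2), with ones exactly in the positions
`(i, i + 1 mod L)`: multiplying a row vector by it shifts the vector by one position to the
right. -/
def cyclicPermMatrix (L : ℕ) : Matrix (Fin L) (Fin L) (ZMod 2) :=
  Matrix.of fun i j => if (j : ℕ) = ((i : ℕ) + 1) % L then 1 else 0

/-- The matrices `∑ j < L, a j • C ^ j` with `a j ∈ {0, 1}` and at most `δ` of the `a j` nonzero,
where `C` is the cyclic permutation matrix; `S` is the set of those `j` with `a j = 1`. -/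
def circularShiftKernels (L δ : ℕ) : Set (Matrix (Fin L) (Fin L) (ZMod 2)) :=
  {M | ∃ S ⊆ Finset.range L, S.card ≤ δ ∧ M = ∑ j ∈ S, cyclicPermMatrix L ^ j}

namespace MulticastNetwork

variable {V E : Type*} [Fintype E] [DecidableEq V] [DecidableEq E] (N : MulticastNetwork V E)

/-- An assignment of local encoding kernels to the pairs of edges, zero on pairs that are not
adjacent. -/
def IsVectorLinearCode {L : ℕ} (K : E → E → Matrix (Fin L) (Fin L) (ZMod 2)) : Prop :=
  ∀ d e, ¬ N.Adjacent d e → K d e = 0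

/-- An `L`-dimensional circular-shift linear code of degree `δ`. -/
def IsCircularShiftCode {L : ℕ} (δ : ℕ) (K : E → E → Matrix (Fin L) (Fin L) (ZMod 2)) : Prop :=
  N.IsVectorLinearCode K ∧ ∀ d e, K d e ∈ circularShiftKernels L δ

/-- The global encoding kernel `F e` of the edge `e`: the data unit on `e` is
`[m_d]_{d ∈ Out(s)} * F e`. For `e ∈ Out(s)` it selects the block of `e`; for an edge `e` leaving
another node `v` it is `∑ d ∈ In(v), F d * K d e`. -/
def globalKernel {L : ℕ} (K : E → E → Matrix (Fin L) (Fin L) (ZMod 2)) :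
    E → Matrix (N.Out N.source × Fin L) (Fin L) (ZMod 2) :=
  N.acyclic.wellFounded_adjacent.fix fun e F =>
    if N.src e = N.source then
      Matrix.of fun r c => if r.1.1 = e ∧ r.2 = c then 1 else 0
    else ∑ d : N.In (N.src e), F d.1 d.2 * K d.1 e

theorem globalKernel_eq {L : ℕ} (K : E → E → Matrix (Fin L) (Fin L) (ZMod 2)) (e : E) :
    N.globalKernel K e =
      if N.src e = N.source then
        Matrix.of fun r c => if r.1.1 = e ∧ r.2 = c then 1 else 0
      else ∑ d : N.In (N.src e), N.globalKernel K d.1 * K d.1 e := by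
  unfold globalKernel
  rw [WellFounded.fix_eq]

/-- The column-wise juxtaposition of the global encoding kernels of the incoming edges of `t`. -/
def receivedKernel {L : ℕ} (K : E → E → Matrix (Fin L) (Fin L) (ZMod 2)) (t : V) :
    Matrix (N.Out N.source × Fin L) (N.In t × Fin L) (ZMod 2) :=
  Matrix.of fun r c => N.globalKernel K c.1.1 r c.2

/-- The local encoding kernels `K` with the source encoding matrix `Gs`, for which
`[m_e]_{e ∈ Out(s)} = [m'_i]_{1 ≤ i ≤ ω} * Gs`, form an `(L', L)` linear solution: at every receiver
the received matrix has full rank `ω L'`. -/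
def IsLinearSolution {L' L : ℕ} (K : E → E → Matrix (Fin L) (Fin L) (ZMod 2))
    (Gs : Matrix (Fin N.ω × Fin L') (N.Out N.source × Fin L) (ZMod 2)) : Prop :=
  N.IsVectorLinearCode K ∧ ∀ t ∈ N.receivers, (Gs * N.receivedKernel K t).rank = N.ω * L'

/-- The network has an `(L', L)` circular-shift linear solution (of some degree `δ ≤ L`). -/
def HasCircularShiftSolution (L' L : ℕ) : Prop :=
  ∃ δ ≤ L, ∃ (K : E → E → Matrix (Fin L) (Fin L) (ZMod 2))
    (Gs : Matrix (Fin N.ω × Fin L') (N.Out N.source × Fin L) (ZMod 2)),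
    N.IsCircularShiftCode δ K ∧ N.IsLinearSolution K Gs

/-- Circular-shift linear solutions exist at rates `L' / L` arbitrarily close to `1`. -/
def IsAsymptoticallyCircularShiftSolvable : Prop :=
  ∀ ε : ℝ, 0 < ε → ∃ L' L : ℕ, 0 < L ∧ 1 - ε < (L' : ℝ) / L ∧ N.HasCircularShiftSolution L' L

end MulticastNetwork

/-! For prime `L`, work over the finite ring R = GF(2)[x]/Φ_L. In a residue field of R (for `L ≠ 2`)
the image of x has order `L`, so the field has 2^d elements with `L` dividing 2^d - 1; hence d is at
least the order of 2 modulo `L`, and the field has more elements than there are receivers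
(`orderOf_lt_card_residueField`).

This suffices for a scalar solution over R (`exists_scalar_solution`). Edges are processed in
topological order, keeping for each receiver a basis formed by the vectors on a cut of its disjoint
paths. A new edge needs a vector that keeps several determinants units simultaneously;
`exists_mem_forall_isUnit` finds it modulo each maximal ideal and lifts by the Chinese remainder
theorem.

Replacing x by the cyclic matrix C is not a ring homomorphism on R, because Φ_L(C) is the all-ones
matrix and not zero. Left multiplication by the even-weight matrix B kills it, so r ↦ B r(C) is
compatible with products. Encoding with B at the source thus carries the scalar solution, decoders
included, over to circulant matrices; B has `L - 1` rows, whence the rate. -/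

/-! ### Avoiding zeros of linear forms over fields and semilocal rings. -/

/-- Fewer than `|k|` nonzero linear forms over a field `k` have a common non-zero. -/
theorem exists_forall_linearForm_ne_zero {k V ι : Type*} [Field k] [AddCommGroup V] [Module k V]
    (T : Finset ι) (hT : T.card < Nat.card k) (φ : ι → V →ₗ[k] k) (hφ : ∀ t ∈ T, φ t ≠ 0) :
    ∃ x, ∀ t ∈ T, φ t x ≠ 0 := by
  classical
  have : Finite k := Nat.finite_of_card_ne_zero (by omega)
  have := Fintype.ofFinite k
  induction T using Finset.induction_on with
  | empty => exact ⟨0, by simp⟩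
  | insert s T hs ih =>
    rw [Finset.card_insert_of_notMem hs] at hT
    obtain ⟨x, hx⟩ := ih (by omega) fun t ht => hφ t (Finset.mem_insert_of_mem ht)
    by_cases hsx : φ s x = 0
    · obtain ⟨y, hy⟩ : ∃ y, φ s y ≠ 0 := by
        by_contra! h
        exact hφ s (Finset.mem_insert_self _ _) (LinearMap.ext h)
      -- Along the line `x + a • y`, the form `φ s` excludes only `a = 0`, and each other form
      -- excludes at most one value of `a`.
      have hcard : (insert 0 (T.image fun t => -φ t x / φ t y)).card <
          (Finset.univ : Finset k).card := by
        rw [Finset.card_univ, ← Nat.card_eq_fintype_card]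
        refine (Finset.card_insert_le _ _).trans_lt (lt_of_le_of_lt ?_ hT)
        exact Nat.succ_le_succ Finset.card_image_le
      obtain ⟨a, -, ha⟩ := Finset.exists_mem_notMem_of_card_lt_card hcard
      simp only [Finset.mem_insert, Finset.mem_image, not_or, not_exists, not_and] at ha
      refine ⟨x + a • y, fun t ht => ?_⟩
      rw [map_add, map_smul, smul_eq_mul]
      rcases Finset.mem_insert.1 ht with rfl | ht
      · rw [hsx, zero_add]
        exact mul_ne_zero ha.1 hy
      · intro h
        by_cases hty : φ t y = 0
        · exact hx t ht (by simpa [hty] using h)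
        · refine ha.2 t ht ?_
          rw [div_eq_iff hty]
          linear_combination -h
    · refine ⟨x, fun t ht => ?_⟩
      rcases Finset.mem_insert.1 ht with rfl | ht
      exacts [hsx, hx t ht]

/-- Over a semilocal ring whose residue fields have more than `|T|` elements, linear forms `φ t`,
`t ∈ T`, that each take a unit value on the submodule `U` take unit values at a common point. -/
theorem exists_mem_forall_isUnit {R M ι : Type*} [CommRing R] [Finite (MaximalSpectrum R)]
    [AddCommGroup M] [Module R M] (T : Finset ι)
    (hT : ∀ m : MaximalSpectrum R, T.card < Nat.card (R ⧸ m.asIdeal)) (U : Submodule R M)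
    (φ : ι → M →ₗ[R] R) (u : ι → M) (hu : ∀ t ∈ T, u t ∈ U) (hφ : ∀ t ∈ T, IsUnit (φ t (u t))) :
    ∃ x ∈ U, ∀ t ∈ T, IsUnit (φ t x) := by
  classical
  have key (m : MaximalSpectrum R) : ∃ a : ι → R ⧸ m.asIdeal, ∀ t ∈ T,
      ∑ s ∈ T, Ideal.Quotient.mk m.asIdeal (φ t (u s)) * a s ≠ 0 := by
    have := m.isMaximal
    let := Ideal.Quotient.field m.asIdeal
    let ψ (t : ι) : (ι → R ⧸ m.asIdeal) →ₗ[R ⧸ m.asIdeal] R ⧸ m.asIdeal :=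
      ∑ s ∈ T, Ideal.Quotient.mk m.asIdeal (φ t (u s)) • LinearMap.proj s
    have hψ (t a) : ψ t a = ∑ s ∈ T, Ideal.Quotient.mk m.asIdeal (φ t (u s)) * a s := by
      simp [ψ, LinearMap.sum_apply]
    -- The form `ψ t` is nonzero because its value at the `t`-th unit vector is the residue of the
    -- unit `φ t (u t)`.
    obtain ⟨a, ha⟩ := exists_forall_linearForm_ne_zero T (hT m) ψ fun t ht h => by
      have h1 := hψ t (Pi.single t 1)
      rw [h, LinearMap.zero_apply, Finset.sum_eq_single t] at h1
      · rw [Pi.single_eq_same, mul_one] at h1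
        exact ((hφ t ht).map (Ideal.Quotient.mk m.asIdeal)).ne_zero h1.symm
      · intro s _ hst
        rw [Pi.single_eq_of_ne hst, mul_zero]
      · exact fun h => absurd ht h
    exact ⟨a, fun t ht => hψ t a ▸ ha t ht⟩
  choose a ha using key
  -- Chinese remainder theorem: the coefficients chosen modulo each maximal ideal lift to R.
  have hlift (s : ι) : ∃ b : R, ∀ m : MaximalSpectrum R, Ideal.Quotient.mk m.asIdeal b = a m s :=
    Ideal.pi_quotient_surjective (fun _ _ h => MaximalSpectrum.isCoprime_of_ne h) fun m => a m s
  choose b hb using hlift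
  refine ⟨∑ s ∈ T, b s • u s, U.sum_mem fun s hs => U.smul_mem _ (hu s hs), fun t ht => ?_⟩
  by_contra hunit
  obtain ⟨I, hI, hmem⟩ := exists_max_ideal_of_mem_nonunits hunit
  refine ha ⟨I, hI⟩ t ht ?_
  rw [← Ideal.Quotient.eq_zero_iff_mem, map_sum, map_sum] at hmem
  rw [← hmem]
  refine Finset.sum_congr rfl fun s _ => ?_
  rw [map_smul, smul_eq_mul, map_mul, mul_comm, ← hb s ⟨I, hI⟩]

/-! ### Scalar linear codes built along edge-disjoint paths. -/

namespace DirectedMultigraph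

variable {V E : Type*} {G : DirectedMultigraph V E}

theorem IsPath.exists_adjacent {a e : E} {p : List E} {u v : V} (hp : G.IsPath u (a :: p) v)
    (he : e ∈ p) : ∃ d ∈ a :: p, G.Adjacent d e := by
  induction p generalizing a u with
  | nil => simp at he
  | cons b p ih =>
    rcases List.mem_cons.1 he with rfl | he
    · exact ⟨a, by simp, hp.2.1.symm⟩
    · obtain ⟨d, hd, h⟩ := ih hp.2 he
      exact ⟨d, List.mem_cons_of_mem _ hd, h⟩

/-- An edge of a path that no edge of the path precedes is the first one, and does not recur. -/
theorem IsPath.eq_cons {e : E} {p : List E} {u v : V} (hp : G.IsPath u p v) (he : e ∈ p)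
    (hmin : ∀ d ∈ p, ¬ G.Adjacent d e) : ∃ p', p = e :: p' ∧ e ∉ p' := by
  cases p with
  | nil => simp at he
  | cons a p =>
    have hep : e ∉ p := fun h => by
      obtain ⟨d, hd, hde⟩ := hp.exists_adjacent h
      exact hmin d hd hde
    rcases List.mem_cons.1 he with rfl | h
    · exact ⟨p, rfl, hep⟩
    · exact absurd h hep

variable [DecidableEq V] [DecidableEq E]

/-- The situation after the edges of `S` have been given vectors `f`: on the `i`-th path to the
receiver `τ t`, the current edge is `c t i` (none at the start), the edges `q t i` are still to come,
and for each `t` the vectors of the current edges form a basis of `Fin n → R`. -/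
structure FlowState (G : DirectedMultigraph V E) {R ι : Type*} [CommRing R] {n : ℕ} (s : V)
    (τ : ι → V) (S : Finset E) (f : E → Fin n → R) (c : ι → Fin n → Option E)
    (q : ι → Fin n → List E) : Prop where
  lower : ∀ d e, G.Adjacent d e → e ∈ S → d ∈ S
  mem_span : ∀ e ∈ S, G.src e ≠ s → f e ∈ Submodule.span R (f '' {d | G.Adjacent d e})
  current_mem : ∀ t i, ∀ d ∈ c t i, d ∈ S
  isPath : ∀ t i, G.IsPath ((c t i).elim s G.dst) (q t i) (τ t)
  notMem : ∀ t i, ∀ e ∈ q t i, e ∉ S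
  disjoint : ∀ t, Pairwise fun i j => (q t i).Disjoint (q t j)
  isUnit_det : ∀ t, IsUnit (Matrix.of fun i => (c t i).elim (Pi.single i 1) f).det

/-- For each receiver at most one path uses `e`, and there `e` comes next. Advancing that path
replaces one row of the basis matrix, so its determinant is a linear form in the new vector. The
replaced row is itself an admissible vector with unit value, as `exists_mem_forall_isUnit` requires.
-/
theorem FlowState.exists_insert {R ι : Type*} [CommRing R] [Finite (MaximalSpectrum R)]
    [Fintype ι] (hR : ∀ m : MaximalSpectrum R, Fintype.card ι < Nat.card (R ⧸ m.asIdeal))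
    {n : ℕ} {s : V} {τ : ι → V} {S : Finset E} {f : E → Fin n → R} {c : ι → Fin n → Option E}
    {q : ι → Fin n → List E} (h : G.FlowState s τ S f c q) {e : E} (he : e ∉ S)
    (hmin : ∀ d, G.Adjacent d e → d ∈ S) :
    ∃ (f' : E → Fin n → R) (c' : ι → Fin n → Option E) (q' : ι → Fin n → List E),
      G.FlowState s τ (insert e S) f' c' q' := by
  classical
  have hcons (t i) (hi : e ∈ q t i) : ∃ p', q t i = e :: p' ∧ e ∉ p' :=
    (h.isPath t i).eq_cons hi fun d hd hde => h.notMem t i d hd (hmin d hde)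
  have huniq {t i j} (hi : e ∈ q t i) (hj : e ∈ q t j) : i = j := by
    by_contra hij
    exact h.disjoint t hij hi hj
  let M (t : ι) : Matrix (Fin n) (Fin n) R :=
    Matrix.of fun i => (c t i).elim (Pi.single i 1) f
  let T : Finset ι := Finset.univ.filter fun t => ∃ i, e ∈ q t i
  -- The vectors that `e` may carry: any at the source, elsewhere only combinations of those on the
  -- edges entering its tail.
  let U : Submodule R (Fin n → R) :=
    if G.src e = s then ⊤ else Submodule.span R (f '' {d | G.Adjacent d e})
  have hidx (t : ι) : ∃ φ : (Fin n → R) →ₗ[R] R, ∃ u : Fin n → R, t ∈ T →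
      u ∈ U ∧ IsUnit (φ u) ∧ ∀ i, e ∈ q t i → ∀ x, φ x = ((M t).updateRow i x).det := by
    by_cases ht : t ∈ T
    · obtain ⟨i, hi⟩ := (Finset.mem_filter.1 ht).2
      refine ⟨(Matrix.detRowAlternating (n := Fin n) (R := R)).toMultilinearMap.toLinearMap (M t) i,
        M t i, fun _ => ⟨?_, ?_, ?_⟩⟩
      · obtain ⟨p', hp', -⟩ := hcons t i hi
        have hsrc := h.isPath t i
        rw [hp'] at hsrc
        have hsrc := hsrc.1
        by_cases hs : G.src e = s
        · simp [U, hs]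
        · have hrow : M t i = (c t i).elim (Pi.single i 1) f := rfl
          simp only [U, if_neg hs, hrow]
          cases hc : c t i with
          | none => exact absurd (by simpa [hc] using hsrc) hs
          | some d =>
            refine Submodule.subset_span ⟨d, ?_, rfl⟩
            simpa [hc, Adjacent] using hsrc.symm
      · have : ((M t).updateRow i (M t i)).det = (M t).det := by rw [Matrix.updateRow_eq_self]
        have h2 := h.isUnit_det t
        change IsUnit (((M t).updateRow i (M t i)).det)
        rwa [this]
      · intro j hj x
        obtain rfl := huniq hi hj
        rfl
    · exact ⟨0, 0, fun h => absurd h ht⟩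
  choose φ u hφ using hidx
  obtain ⟨x, hxU, hx⟩ := exists_mem_forall_isUnit T
    (fun m => (Finset.card_le_univ T).trans_lt (hR m)) U φ u (fun t ht => (hφ t ht).1)
    (fun t ht => (hφ t ht).2.1)
  have hf' {d} (hd : d ∈ S) : Function.update f e x d = f d :=
    Function.update_of_ne (fun h : d = e => he (h ▸ hd)) _ _
  have hspan (a : E) (ha : ∀ d, G.Adjacent d a → d ∈ S) :
      Function.update f e x '' {d | G.Adjacent d a} = f '' {d | G.Adjacent d a} :=
    Set.image_congr fun d hd => hf' (ha d hd)
  refine ⟨Function.update f e x, fun t i => if e ∈ q t i then some e else c t i,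
    fun t i => if e ∈ q t i then (q t i).tail else q t i, ?_, ?_, ?_, ?_, ?_, ?_, ?_⟩
  · intro d a hda ha
    rcases Finset.mem_insert.1 ha with rfl | ha
    · exact Finset.mem_insert_of_mem (hmin d hda)
    · exact Finset.mem_insert_of_mem (h.lower d a hda ha)
  · intro a ha has
    rcases Finset.mem_insert.1 ha with rfl | ha
    · rw [hspan a hmin, Function.update_self]
      simpa only [U, if_neg has] using hxU
    · rw [hspan a fun d hd => h.lower d a hd ha, hf' ha]
      exact h.mem_span a ha has
  · intro t i d hd
    split_ifs at hd with hi
    · obtain rfl : e = d := by simpa using hd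
      exact Finset.mem_insert_self _ _
    · exact Finset.mem_insert_of_mem (h.current_mem t i d hd)
  · intro t i
    have hp := h.isPath t i
    by_cases hi : e ∈ q t i
    · obtain ⟨p', hp', -⟩ := hcons t i hi
      simp only [if_pos hi]
      rw [hp'] at hp ⊢
      exact hp.2
    · simpa only [if_neg hi] using hp
  · intro t i a ha
    by_cases hi : e ∈ q t i
    · obtain ⟨p', hp', hep⟩ := hcons t i hi
      have hn := h.notMem t i a
      simp only [if_pos hi] at ha
      rw [hp'] at ha hn
      simp only [Finset.mem_insert, not_or]
      exact ⟨fun h => hep (h ▸ ha), hn (List.mem_cons_of_mem _ ha)⟩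
    · simp only [if_neg hi] at ha
      simp only [Finset.mem_insert, not_or]
      exact ⟨fun h => hi (h ▸ ha), h.notMem t i a ha⟩
  · intro t i j hij
    have hsub (l) : (if e ∈ q t l then (q t l).tail else q t l) ⊆ q t l := by
      split_ifs
      exacts [List.tail_subset _, List.Subset.refl _]
    exact fun a hi hj => h.disjoint t hij (hsub i hi) (hsub j hj)
  · intro t
    have helim (i) (o : Option E) (ho : ∀ d ∈ o, d ∈ S) :
        o.elim (Pi.single i 1) (Function.update f e x) = o.elim (Pi.single i 1) f := by
      cases o with
      | none => rfl
      | some d => exact hf' (ho d rfl)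
    by_cases ht : t ∈ T
    · obtain ⟨i, hi⟩ := (Finset.mem_filter.1 ht).2
      have := hx t ht
      rw [(hφ t ht).2.2 i hi] at this
      convert this using 2
      ext j l
      by_cases hj : j = i
      · subst hj
        simp [hi]
      · have hj' : e ∉ q t j := fun h => hj (huniq h hi)
        simp only [Matrix.of_apply, if_neg hj', Matrix.updateRow_ne hj, M]
        rw [helim _ _ (h.current_mem t j)]
    · convert h.isUnit_det t using 4 with i
      have hi : e ∉ q t i := fun hi => ht (Finset.mem_filter.2 ⟨Finset.mem_univ _, i, hi⟩)
      simp only [if_neg hi]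
      exact helim _ _ (h.current_mem t i)

/-- The scalar linear solution of a multicast network over a semilocal ring whose residue fields
have more elements than there are receivers. -/
theorem exists_scalar_solution [Fintype E] (hG : G.IsAcyclic) {R ι : Type*} [CommRing R]
    [Finite (MaximalSpectrum R)] [Fintype ι]
    (hR : ∀ m : MaximalSpectrum R, Fintype.card ι < Nat.card (R ⧸ m.asIdeal))
    {n : ℕ} {s : V} {τ : ι → V} (hτ : ∀ t, τ t ≠ s) (hflow : ∀ t, G.HasEdgeDisjointPaths n s (τ t)) :
    ∃ (f : E → Fin n → R) (K : E → E → R) (D : (t : ι) → G.In (τ t) → Fin n → R),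
      (∀ e, G.src e ≠ s → f e = ∑ d : G.In (G.src e), K d e • f d) ∧
      ∀ t i j, ∑ d, f d.1 i * D t d j = if i = j then 1 else 0 := by
  classical
  choose P hP hdisj using hflow
  -- With no current edges the rows are the standard basis.
  have hstart : G.FlowState s τ ∅ (fun _ _ => (0 : R)) (fun _ _ => none) P :=
    ⟨by simp, by simp, by simp, hP, by simp, hdisj, fun t => by
      have : (Matrix.of fun i : Fin n => (Pi.single i 1 : Fin n → R)) = 1 := by
        ext i j
        simp [Matrix.one_apply, Pi.single_apply, eq_comm]
      simp [this]⟩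
  have hall (S : Finset E) (hS : ∃ (f : E → Fin n → R) (c : ι → Fin n → Option E)
      (q : ι → Fin n → List E), G.FlowState s τ S f c q) :
      ∃ (f : E → Fin n → R) (c : ι → Fin n → Option E) (q : ι → Fin n → List E),
        G.FlowState s τ Finset.univ f c q := by
    induction S using WellFoundedGT.induction with
    | ind S ih =>
      by_cases huniv : S = Finset.univ
      · exact huniv ▸ hS
      · obtain ⟨e, he, hmin⟩ := hG.wellFounded_adjacent.has_min {e | e ∉ S} (by
          by_contra! hempty
          refine huniv (Finset.eq_univ_of_forall fun e => ?_)
          by_contra he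
          exact Set.eq_empty_iff_forall_notMem.1 hempty e he)
        obtain ⟨f, c, q, h⟩ := hS
        exact ih (insert e S) (Finset.ssubset_insert he)
          (h.exists_insert hR he fun d hd => by_contra fun hdS => hmin d hdS hd)
  obtain ⟨f, c, q, h⟩ := hall ∅ ⟨_, _, _, hstart⟩
  -- Once all edges are processed nothing remains of any path, so each current edge enters the
  -- receiver; having none would force the receiver to be the source.
  have hlast (t i) : ∃ d : G.In (τ t), c t i = some d.1 := by
    have hp := h.isPath t i
    have hq : q t i = [] := List.eq_nil_iff_forall_not_mem.2 fun e he =>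
      h.notMem t i e he (Finset.mem_univ e)
    rw [hq] at hp
    cases hc : c t i with
    | none => exact absurd (by simpa [hc, IsPath] using hp.symm) (hτ t)
    | some d => exact ⟨⟨d, by simpa [hc, IsPath] using hp⟩, rfl⟩
  choose g hg using hlast
  have hK (e : E) : ∃ k : E → R, G.src e ≠ s → f e = ∑ d : G.In (G.src e), k d • f d := by
    by_cases hs : G.src e = s
    · exact ⟨0, fun h => absurd hs h⟩
    · have hmem := h.mem_span e (Finset.mem_univ e) hs
      have himage : f '' {d | G.Adjacent d e} = Set.range fun d : G.In (G.src e) => f d := by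
        ext y
        simp [Adjacent]
      rw [himage, Submodule.mem_span_range_iff_exists_fun] at hmem
      obtain ⟨k, hk⟩ := hmem
      refine ⟨fun d => if hd : G.dst d = G.src e then k ⟨d, hd⟩ else 0, fun _ => ?_⟩
      rw [← hk]
      refine Finset.sum_congr rfl fun d _ => ?_
      simp only [dif_pos d.2]
  choose k hk using hK
  let M (t : ι) : Matrix (Fin n) (Fin n) R := Matrix.of fun i => f (g t i)
  have hM (t) : IsUnit (M t).det := by
    have := h.isUnit_det t
    simpa only [hg, Option.elim_some] using this
  -- The decoder is the inverse of the transposed basis matrix. Summing over `l` avoids having to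
  -- show that `g t` is injective.
  refine ⟨f, fun d e => k e d, fun t d j => ∑ l, if g t l = d then (M t).transpose⁻¹ l j else 0, hk,
    fun t i j => ?_⟩
  have hinv : (M t).transpose * (M t).transpose⁻¹ = 1 :=
    Matrix.mul_nonsing_inv _ (by rw [Matrix.det_transpose]; exact hM t)
  have hij := congrFun (congrFun hinv i) j
  rw [Matrix.one_apply, Matrix.mul_apply] at hij
  rw [← hij]
  simp only [Finset.mul_sum, mul_ite, mul_zero]
  rw [Finset.sum_comm]
  refine Finset.sum_congr rfl fun l _ => ?_
  simp [M]

end DirectedMultigraph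

/-! ### Circulant matrices and GF(2)[x]/Φ_L. -/

open Polynomial

theorem cyclicPermMatrix_pow_apply {L : ℕ} (n : ℕ) (i j : Fin L) :
    (cyclicPermMatrix L ^ n) i j = if (j : ℕ) = ((i : ℕ) + n) % L then 1 else 0 := by
  induction n generalizing j with
  | zero => simp [Matrix.one_apply, Fin.ext_iff, Nat.mod_eq_of_lt i.2, eq_comm]
  | succ n ih =>
    have hL : 0 < L := i.pos
    rw [pow_succ, Matrix.mul_apply, Finset.sum_eq_single ⟨(i + n) % L, Nat.mod_lt _ hL⟩]
    · rw [ih, if_pos rfl, one_mul]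
      simp [cyclicPermMatrix, add_assoc]
    · intro b _ hb
      rw [ih, if_neg fun h => hb (Fin.ext h), zero_mul]
    · simp

/-- `1 + C + ⋯ + C ^ (L - 1)` is the all-ones matrix. -/
theorem sum_cyclicPermMatrix_pow_apply {L : ℕ} (i j : Fin L) :
    (∑ n ∈ Finset.range L, cyclicPermMatrix L ^ n) i j = 1 := by
  have hi := i.2
  have hj := j.2
  rw [Matrix.sum_apply]
  simp only [cyclicPermMatrix_pow_apply]
  -- The only shift taking `i` to `j` is `j - i` modulo `L`.
  rw [Finset.sum_eq_single ((j + (L - i)) % L)]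
  · rw [if_pos]
    rw [Nat.add_mod_mod, show (i : ℕ) + (j + (L - i)) = j + L by omega, Nat.add_mod_right,
      Nat.mod_eq_of_lt hj]
  · intro n hn hne
    rw [if_neg]
    intro h
    apply hne
    rw [h, Nat.mod_add_mod, show (i : ℕ) + n + (L - i) = n + L by omega, Nat.add_mod_right,
      Nat.mod_eq_of_lt (Finset.mem_range.1 hn)]
  · intro h
    exact absurd (Finset.mem_range.2 (Nat.mod_lt _ (by omega))) h

theorem aeval_cyclicPermMatrix_mem {L : ℕ} {p : (ZMod 2)[X]} (hp : p.natDegree < L) :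
    aeval (cyclicPermMatrix L) p ∈ circularShiftKernels L L := by
  refine ⟨(Finset.range L).filter fun j => p.coeff j = 1, Finset.filter_subset _ _, ?_, ?_⟩
  · exact (Finset.card_filter_le _ _).trans (Finset.card_range L).le
  · rw [aeval_eq_sum_range' hp, Finset.sum_filter]
    refine Finset.sum_congr rfl fun j _ => ?_
    have h01 : ∀ a : ZMod 2, a = 0 ∨ a = 1 := by decide
    rcases h01 (p.coeff j) with h | h <;> simp [h]

/-- A basis of the space of the row vectors of length `L` and even weight. -/
def evenWeightMatrix (L : ℕ) : Matrix (Fin (L - 1)) (Fin L) (ZMod 2) :=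
  Matrix.of fun i j => if (j : ℕ) = i ∨ (j : ℕ) = L - 1 then 1 else 0

/-- For prime `L`, Φ_L(C) is the all-ones matrix, and the two ones in each row of the left factor
cancel modulo 2. -/
theorem evenWeightMatrix_mul_cyclotomic {L : ℕ} (hL : L.Prime) :
    evenWeightMatrix L * aeval (cyclicPermMatrix L) (cyclotomic L (ZMod 2)) = 0 := by
  have := Fact.mk hL
  rw [cyclotomic_prime, map_sum]
  simp only [map_pow, aeval_X]
  ext i j
  have hi := i.2
  simp only [Matrix.mul_apply, sum_cyclicPermMatrix_pow_apply, mul_one, evenWeightMatrix,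
    Matrix.of_apply, Matrix.zero_apply]
  rw [Finset.sum_boole]
  have : (Finset.univ.filter fun x : Fin L => (x : ℕ) = i ∨ (x : ℕ) = L - 1) =
      {⟨i, by omega⟩, ⟨L - 1, by omega⟩} := by
    ext x
    simp [Fin.ext_iff]
  rw [this, Finset.card_pair (by simp [Fin.ext_iff]; omega)]
  rfl

theorem evenWeightMatrix_mul_rightInverse (L : ℕ) :
    evenWeightMatrix L * (Matrix.of fun i j => if (i : ℕ) = j then 1 else 0 :
      Matrix (Fin L) (Fin (L - 1)) (ZMod 2)) = 1 := by
  ext i j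
  have hi := i.2
  have hj := j.2
  rw [Matrix.mul_apply, Finset.sum_eq_single ⟨j, by omega⟩]
  · have : (j : ℕ) ≠ L - 1 := by omega
    simp [evenWeightMatrix, Matrix.one_apply, this, Fin.ext_iff, eq_comm]
  · intro b _ hb
    have : (b : ℕ) ≠ j := fun h => hb (Fin.ext h)
    simp [this]
  · simp

/-- The circular-shift matrix that represents an element of `GF(2)[x] / Φ_L`. -/
noncomputable def circularShift (L : ℕ) :
    AdjoinRoot (cyclotomic L (ZMod 2)) →ₗ[ZMod 2] Matrix (Fin L) (Fin L) (ZMod 2) :=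
  (aeval (cyclicPermMatrix L)).toLinearMap ∘ₗ
    AdjoinRoot.modByMonicHom (cyclotomic.monic L (ZMod 2))

theorem circularShift_mem {L : ℕ} (hL : L.Prime) (r : AdjoinRoot (cyclotomic L (ZMod 2))) :
    circularShift L r ∈ circularShiftKernels L L := by
  refine aeval_cyclicPermMatrix_mem ?_
  obtain ⟨p, rfl⟩ := AdjoinRoot.mk_surjective r
  have hdeg : (cyclotomic L (ZMod 2)).natDegree = L - 1 := by
    rw [natDegree_cyclotomic, Nat.totient_prime hL]
  have hL2 := hL.two_le
  have := natDegree_modByMonic_lt p (cyclotomic.monic L (ZMod 2)) fun h => by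
    rw [h, natDegree_one] at hdeg
    omega
  rw [AdjoinRoot.modByMonicHom_mk]
  omega

theorem evenWeightMatrix_mul_circularShift_mk {L : ℕ} (hL : L.Prime) (p : (ZMod 2)[X]) :
    evenWeightMatrix L * circularShift L (AdjoinRoot.mk _ p) =
      evenWeightMatrix L * aeval (cyclicPermMatrix L) p := by
  have h : circularShift L (AdjoinRoot.mk _ p) =
      aeval (cyclicPermMatrix L) (p %ₘ cyclotomic L (ZMod 2)) := rfl
  rw [h, modByMonic_eq_sub_mul_div, map_sub, Matrix.mul_sub, map_mul, ← Matrix.mul_assoc,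
    evenWeightMatrix_mul_cyclotomic hL, Matrix.zero_mul, sub_zero]

/-- Reducing modulo Φ_L changes a polynomial in C by a multiple of Φ_L(C), which the left factor
annihilates. -/
theorem evenWeightMatrix_mul_circularShift_mul {L : ℕ} (hL : L.Prime)
    (r r' : AdjoinRoot (cyclotomic L (ZMod 2))) :
    evenWeightMatrix L * circularShift L (r * r') =
      evenWeightMatrix L * circularShift L r * circularShift L r' := by
  obtain ⟨p, rfl⟩ := AdjoinRoot.mk_surjective r
  obtain ⟨p', rfl⟩ := AdjoinRoot.mk_surjective r'
  rw [← map_mul, evenWeightMatrix_mul_circularShift_mk hL, evenWeightMatrix_mul_circularShift_mk hL,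
    map_mul]
  have h : circularShift L (AdjoinRoot.mk _ p') =
      aeval (cyclicPermMatrix L) (p' %ₘ cyclotomic L (ZMod 2)) := rfl
  have hmk : AdjoinRoot.mk (cyclotomic L (ZMod 2)) (p * p') =
      AdjoinRoot.mk _ (p * (p' %ₘ cyclotomic L (ZMod 2))) := by
    rw [map_mul, map_mul]
    congr 1
    rw [AdjoinRoot.mk_eq_mk, modByMonic_eq_sub_mul_div, sub_sub_cancel]
    exact dvd_mul_right _ _
  rw [h, Matrix.mul_assoc, ← map_mul, ← map_mul, ← evenWeightMatrix_mul_circularShift_mk hL (p * p'),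
    ← evenWeightMatrix_mul_circularShift_mk hL (p * _), hmk]

theorem evenWeightMatrix_mul_circularShift_one {L : ℕ} (hL : L.Prime) :
    evenWeightMatrix L * circularShift L 1 = evenWeightMatrix L := by
  rw [← map_one (AdjoinRoot.mk _), evenWeightMatrix_mul_circularShift_mk hL, map_one,
    Matrix.mul_one]

/-! ### The order of 2 modulo a prime. -/

theorem orderOf_lt_card_residueField {L : ℕ} (hL : L.Prime) (hL2 : L ≠ 2)
    (m : Ideal (AdjoinRoot (cyclotomic L (ZMod 2)))) (hm : m.IsMaximal) :
    orderOf (2 : ZMod L) < Nat.card (AdjoinRoot (cyclotomic L (ZMod 2)) ⧸ m) := by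
  have := Fact.mk hL
  let := Ideal.Quotient.field m
  have := (cyclotomic.monic L (ZMod 2)).finite_adjoinRoot
  have : Finite (AdjoinRoot (cyclotomic L (ZMod 2))) := Module.finite_of_finite (ZMod 2)
  have : Finite (AdjoinRoot (cyclotomic L (ZMod 2)) ⧸ m) :=
    Finite.of_surjective _ Ideal.Quotient.mk_surjective
  let := Fintype.ofFinite (AdjoinRoot (cyclotomic L (ZMod 2)) ⧸ m)
  have : CharP (AdjoinRoot (cyclotomic L (ZMod 2)) ⧸ m) 2 :=
    charP_of_injective_algebraMap (algebraMap (ZMod 2) _).injective 2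
  obtain ⟨d, -, hd⟩ := FiniteField.card (AdjoinRoot (cyclotomic L (ZMod 2)) ⧸ m) 2
  let β := Ideal.Quotient.mk m (AdjoinRoot.root (cyclotomic L (ZMod 2)))
  have hsum : ∑ i ∈ Finset.range L, β ^ i = 0 := by
    have h : Ideal.Quotient.mk m (AdjoinRoot.mk (cyclotomic L (ZMod 2))
        (∑ i ∈ Finset.range L, X ^ i)) = 0 := by
      rw [← cyclotomic_prime, AdjoinRoot.mk_self, map_zero]
    simpa only [map_sum, map_pow, AdjoinRoot.mk_X] using h
  have hβ : β ^ L = 1 := by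
    rw [← sub_eq_zero, ← mul_geom_sum, hsum, mul_zero]
  -- If β were 1, the vanishing geometric sum would be `L` in characteristic 2, making `L` even.
  have hβ1 : β ≠ 1 := by
    intro h
    rw [h] at hsum
    simp only [one_pow, Finset.sum_const, Finset.card_range, nsmul_eq_mul, mul_one] at hsum
    rw [CharP.cast_eq_zero_iff _ 2] at hsum
    exact hL2 ((Nat.prime_dvd_prime_iff_eq Nat.prime_two hL).1 hsum).symm
  have hβ0 : β ≠ 0 := by
    intro h
    rw [h, zero_pow hL.ne_zero] at hβ
    exact zero_ne_one hβ
  have hdvd : L ∣ 2 ^ (d : ℕ) - 1 := by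
    rw [← orderOf_eq_prime hβ hβ1, ← hd]
    exact orderOf_dvd_of_pow_eq_one (FiniteField.pow_card_sub_one_eq_one β hβ0)
  have hpow : (2 : ZMod L) ^ (d : ℕ) = 1 := by
    rw [← CharP.cast_eq_zero_iff (ZMod L) L, Nat.cast_sub Nat.one_le_two_pow] at hdvd
    simpa [sub_eq_zero] using hdvd
  rw [Nat.card_eq_fintype_card, hd]
  exact (orderOf_le_of_pow_eq_one d.pos hpow).trans_lt Nat.lt_two_pow_self

/-- A prime above 2^n + 1 cannot divide 2^k - 1 for 0 < k < n. -/
theorem exists_prime_le_orderOf_two (n : ℕ) :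
    ∃ L : ℕ, L.Prime ∧ n ≤ orderOf (2 : ZMod L) := by
  obtain ⟨L, hL, hprime⟩ := Nat.exists_infinite_primes (2 ^ n + 2)
  have := Fact.mk hprime
  refine ⟨L, hprime, ?_⟩
  by_contra! hlt
  have h2 : (2 : ZMod L) ≠ 0 := by
    intro h
    have h : ((2 : ℕ) : ZMod L) = 0 := by exact_mod_cast h
    rw [CharP.cast_eq_zero_iff (ZMod L) L] at h
    have := Nat.le_of_dvd (by norm_num) h
    have := Nat.one_le_two_pow (n := n)
    omega
  have hpos : 0 < orderOf (2 : ZMod L) := by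
    rw [orderOf_pos_iff]
    exact isOfFinOrder_iff_pow_eq_one.2 ⟨L - 1, by have := hprime.two_le; omega,
      ZMod.pow_card_sub_one_eq_one h2⟩
  have h := pow_orderOf_eq_one (2 : ZMod L)
  have hdvd : L ∣ 2 ^ orderOf (2 : ZMod L) - 1 := by
    rw [← CharP.cast_eq_zero_iff (ZMod L) L, Nat.cast_sub Nat.one_le_two_pow]
    simp [h]
  have h4 : 2 ^ 1 ≤ 2 ^ orderOf (2 : ZMod L) := Nat.pow_le_pow_right (by norm_num) hpos
  have := Nat.le_of_dvd (by omega) hdvd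
  have := Nat.pow_le_pow_right (n := 2) (by norm_num) hlt.le
  omega

/-! ### From scalar solutions to circular-shift solutions. -/

namespace MulticastNetwork

variable {V E : Type*} [Fintype E] [DecidableEq V] [DecidableEq E] (N : MulticastNetwork V E)

theorem hasCircularShiftSolution_of_card_le_orderOf {L : ℕ} (hL : L.Prime) (hL2 : L ≠ 2)
    (hcard : N.receivers.card ≤ orderOf (2 : ZMod L)) : N.HasCircularShiftSolution (L - 1) L := by
  have := (cyclotomic.monic L (ZMod 2)).finite_adjoinRoot
  have : Finite (AdjoinRoot (cyclotomic L (ZMod 2))) := Module.finite_of_finite (ZMod 2)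
  obtain ⟨f, K, D, hf, hD⟩ := DirectedMultigraph.exists_scalar_solution N.acyclic
    (R := AdjoinRoot (cyclotomic L (ZMod 2))) (ι := N.receivers)
    (fun m => by
      rw [Fintype.card_coe]
      exact hcard.trans_lt (orderOf_lt_card_residueField hL hL2 _ m.isMaximal))
    (s := N.source) (τ := fun t => t.1)
    (fun t h => N.source_notMem_receivers (h ▸ t.2)) fun t => N.flow t t.2
  let B := evenWeightMatrix L
  let ρ := circularShift L
  have hmul (r r') : B * ρ (r * r') = B * ρ r * ρ r' :=
    evenWeightMatrix_mul_circularShift_mul hL r r'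
  -- The scalar coefficients are unconstrained on non-adjacent pairs, so they are cut off there.
  let κ (d e : E) : Matrix (Fin L) (Fin L) (ZMod 2) :=
    if N.dst d = N.src e then ρ (K d e) else 0
  have hκ : N.IsVectorLinearCode κ := fun d e h => if_neg h
  let Gs : Matrix (Fin N.ω × Fin (L - 1)) (N.Out N.source × Fin L) (ZMod 2) :=
    Matrix.of fun r c => (B * ρ (f c.1 r.1)) r.2 c.2
  -- After source encoding, each edge carries the image under r ↦ B r(C) of its scalar vector;
  -- multiplicativity passes this along edges.
  have hGs (e : E) : Gs * N.globalKernel κ e =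
      Matrix.of fun r c => (B * ρ (f e r.1)) r.2 c := by
    induction e using N.acyclic.wellFounded_adjacent.induction with
    | _ e ih =>
      rw [N.globalKernel_eq]
      split_ifs with hs
      · ext r c
        rw [Matrix.mul_apply, Finset.sum_eq_single (⟨e, hs⟩, c)]
        · simp [Gs]
        · intro b _ hb
          rw [Matrix.of_apply, if_neg, mul_zero]
          rintro ⟨h1, h2⟩
          exact hb (Prod.ext (Subtype.ext h1) h2)
        · simp
      · rw [Matrix.mul_sum]
        ext r c
        simp only [Matrix.of_apply]
        rw [hf e hs, Finset.sum_apply, map_sum, Matrix.mul_sum, Matrix.sum_apply, Matrix.sum_apply]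
        refine Finset.sum_congr rfl fun d _ => ?_
        rw [← Matrix.mul_assoc, ih d d.2, Pi.smul_apply, smul_eq_mul, mul_comm, hmul]
        simp only [κ, if_pos d.2]
        simp [Matrix.mul_apply]
  refine ⟨L, le_rfl, κ, Gs, ⟨hκ, fun d e => ?_⟩, hκ, fun t ht => ?_⟩
  · by_cases h : N.dst d = N.src e
    · simpa only [κ, if_pos h] using circularShift_mem hL _
    · simp only [κ, if_neg h]
      exact ⟨∅, by simp, by simp, by simp⟩
  let B' : Matrix (Fin L) (Fin (L - 1)) (ZMod 2) := Matrix.of fun i j => if (i : ℕ) = j then 1 else 0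
  let X : Matrix (N.In t × Fin L) (Fin N.ω × Fin (L - 1)) (ZMod 2) :=
    Matrix.of fun r c => (ρ (D ⟨t, ht⟩ r.1 c.1) * B') r.2 c.2
  have hrec (r) (d : N.In t) (b : Fin L) :
      (Gs * N.receivedKernel κ t) r (d, b) = (B * ρ (f d r.1)) r.2 b :=
    congrFun (congrFun (hGs d) r) b
  -- The scalar decoder, transported by `ρ` and followed by the right inverse `B'` of `B`, is a
  -- right inverse of the received matrix, which forces full row rank.
  have hX : Gs * N.receivedKernel κ t * X = 1 := by
    ext ⟨i, a⟩ ⟨j, b⟩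
    rw [Matrix.mul_apply, Fintype.sum_prod_type]
    have hd (d : N.In t) : ∑ y, (Gs * N.receivedKernel κ t) (i, a) (d, y) * X (d, y) (j, b) =
        (B * ρ (f d i * D ⟨t, ht⟩ d j) * B') a b := by
      rw [hmul, Matrix.mul_assoc _ _ B', Matrix.mul_apply]
      simp only [hrec, X, Matrix.of_apply]
    simp only [hd]
    rw [← Matrix.sum_apply, ← Matrix.sum_mul, ← Matrix.mul_sum, ← map_sum, hD ⟨t, ht⟩ i j]
    by_cases hij : i = j
    · subst hij
      rw [if_pos rfl, evenWeightMatrix_mul_circularShift_one hL,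
        evenWeightMatrix_mul_rightInverse]
      simp [Matrix.one_apply]
    · rw [if_neg hij, map_zero]
      simp [hij]
  refine le_antisymm ((Matrix.rank_le_card_height _).trans_eq (by simp)) ?_
  have h := Matrix.rank_mul_le_left (Gs * N.receivedKernel κ t) X
  rw [hX, Matrix.rank_one] at h
  simpa using h

end MulticastNetwork

theorem theorem4 {V E : Type*} [Finite V] [Fintype E] [DecidableEq V] [DecidableEq E]
    (N : MulticastNetwork V E) :
    N.IsAsymptoticallyCircularShiftSolvable ∧
      ∀ ε : ℝ, 0 < ε →
        (∃ L : ℕ, L.Prime ∧ max (1 / ε) (N.receivers.card : ℝ) ≤ (orderOf (2 : ZMod L) : ℝ)) ∧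
        ∀ L : ℕ, L.Prime → max (1 / ε) (N.receivers.card : ℝ) ≤ (orderOf (2 : ZMod L) : ℝ) →
          1 - ε < ((L - 1 : ℕ) : ℝ) / (L : ℝ) ∧ N.HasCircularShiftSolution (L - 1) L := by
  have hexists (ε : ℝ) : ∃ L : ℕ, L.Prime ∧
      max (1 / ε) (N.receivers.card : ℝ) ≤ (orderOf (2 : ZMod L) : ℝ) := by
    obtain ⟨n, hn⟩ := exists_nat_ge (max (1 / ε) (N.receivers.card : ℝ))
    obtain ⟨L, hL, h⟩ := exists_prime_le_orderOf_two n
    exact ⟨L, hL, hn.trans (by exact_mod_cast h)⟩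
  have hall (ε : ℝ) (hε : 0 < ε) (L : ℕ) (hL : L.Prime)
      (hle : max (1 / ε) (N.receivers.card : ℝ) ≤ (orderOf (2 : ZMod L) : ℝ)) :
      1 - ε < ((L - 1 : ℕ) : ℝ) / (L : ℝ) ∧ N.HasCircularShiftSolution (L - 1) L := by
    have := Fact.mk hL
    have hε' := (le_max_left _ _).trans hle
    have hpos : 0 < orderOf (2 : ZMod L) := by
      have : (0 : ℝ) < orderOf (2 : ZMod L) := (one_div_pos.2 hε).trans_le hε'
      exact_mod_cast this
    have hlt : orderOf (2 : ZMod L) < L := by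
      have h2 : (2 : ZMod L) ≠ 0 := by
        intro h
        have := pow_orderOf_eq_one (2 : ZMod L)
        rw [h] at this hpos
        rw [zero_pow hpos.ne'] at this
        exact zero_ne_one this
      have := orderOf_le_of_pow_eq_one (Nat.sub_pos_of_lt hL.one_lt)
        (ZMod.pow_card_sub_one_eq_one h2)
      have := hL.one_lt
      omega
    have hL0 : (0 : ℝ) < L := by exact_mod_cast hL.pos
    refine ⟨?_, N.hasCircularShiftSolution_of_card_le_orderOf hL ?_ ?_⟩
    · have hltR : (orderOf (2 : ZMod L) : ℝ) < L := by exact_mod_cast hlt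
      have h1 : 1 / ε < L := hε'.trans_lt hltR
      rw [div_lt_iff₀ hε] at h1
      rw [lt_div_iff₀ hL0, Nat.cast_sub hL.one_le, Nat.cast_one]
      linarith
    -- Modulo 2 the element 2 is zero, and no positive power of it is 1, contrary to `hpos`.
    · rintro rfl
      have h := pow_orderOf_eq_one (2 : ZMod 2)
      rw [show (2 : ZMod 2) = 0 from rfl] at h hpos
      rw [zero_pow hpos.ne'] at h
      exact zero_ne_one h
    · exact_mod_cast (le_max_right _ _).trans hle
  refine ⟨fun ε hε => ?_, fun ε hε => ⟨hexists ε, hall ε hε⟩⟩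
  obtain ⟨L, hL, h⟩ := hexists ε
  exact ⟨L - 1, L, hL.pos, hall ε hε L hL h⟩
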